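/- Let $d\ge 3$ be an integer and $p$ a prime. For $x\in\mathbb F_p^d$ let $\Phi(x)=(n_0,\dots,n_{p-1})\in\mathbb R^p$, where $n_a$ is the number of coordinates of $x$ equal to $a$. Let $\mathcal U_{d,p}$ be the multiset $\{\Phi(x): x\in\mathbb F_p^d,\ x_1+\dots+x_d=0\}$, let $X$ be uniformly distributed on $\mathcal U_{d,p}$ (counted with multiplicity), $\mu=\mathbb E X$, and $\phi_{X-\mu}(s)=\mathbb E\exp(i\,s\cdot(X-\mu))$ for $s\in\mathbb R^p$. Let $O$ be a linear isometry from $\mathbb R^{p-1}$ onto the hyperplane $\mathbf 1^\perp\subset\mathbb R^p$, where $\mathbf 1=(1,\dots,1)$, and let $Q(x,y)=Ox+y\mathbf 1/\sqrt p$ for $x\in\mathbb R^{p-1}$, $y\in\mathbb R$. For $\kappa>0$ and $j\in\{0,\dots,p-1\}$ put $$B_j(\kappa)=2\pi j\,(0,1/p,\dots,(p-1)/p)+Q\big(\{x\in\mathbb R^{p-1}:\|x\|_2^2\le\kappa\}\times[0,2\sqrt p\,\pi]\big).$$ **Theorem.** There is an absolute constant $\alpha_0>0$ such that for every integer $d\ge3$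 and every $\alpha\in(0,\alpha_0]$ there is a constant $A>0$, depending only on $\alpha$ and $d$, with the following property. For every prime $p$, every $O$ as above and every $s\in\mathbb R^p$ with $$|\phi_{X-\mu}(s)|\ge 1-\alpha p^{-2},$$ there are $j\in\{0,\dots,p-1\}$ and $0<\kappa\le A/p$ such that $s\in B_j(\kappa)+2\pi\mathbb Z^p$, that is, $s$ belongs to $B_j(\kappa)$ modulo $2\pi\mathbb Z^p$. -/

import Mathlib

noncomputable section

namespace ValueCount

/-- `ℝ^p` with the Euclidean norm, the coordinates being indexed by the elements of `F_p`;
the element `a` of `F_p` stands for its representative `a.val` in `{0, …, p - 1}`. -/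
abbrev Space (p : ℕ) : Type := EuclideanSpace ℝ (ZMod p)

/-- The value-count vector `Φ(x) = (n_0, …, n_{p-1})` of a tuple `x ∈ F_p^d`:
`n_a` is the number of coordinates of `x` that are equal to `a`. -/
def countVector {d p : ℕ} (x : Fin d → ZMod p) : Space p :=
  WithLp.toLp 2 fun a => ((Finset.univ.filter fun i => x i = a).card : ℝ)

/-- The multiset `U_{d,p}` of the vectors `Φ(x)`, where `x` runs over the tuples in `F_p^d`
with sum zero (each tuple contributes one element, so values are repeated). -/
def zeroSumCounts (d p : ℕ) [NeZero p] : Multiset (Space p) :=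
  (Finset.univ.filter fun x : Fin d → ZMod p => ∑ i, x i = 0).val.map countVector

/-- The expectation `E f(X)` for `X` uniformly distributed on a finite multiset `U`. -/
def uniformExpectation {E F : Type*} [AddCommGroup F] [Module ℝ F]
    (U : Multiset E) (f : E → F) : F :=
  (U.card : ℝ)⁻¹ • (U.map f).sum

/-- The mean `μ = E X` of a uniform element `X` of `U_{d,p}`. -/
def mean (d p : ℕ) [NeZero p] : Space p :=
  uniformExpectation (zeroSumCounts d p) fun w => w

/-- The characteristic function `φ_{X-μ}(s) = E exp(i s · (X - μ))`, for `X` uniform on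
`U_{d,p}`. -/
def centeredCharFun (d p : ℕ) [NeZero p] (s : Space p) : ℂ :=
  uniformExpectation (zeroSumCounts d p) fun w =>
    Complex.exp (Complex.I * ((inner ℝ s (w - mean d p) : ℝ) : ℂ))

/-- The all-ones vector. -/
def ones (p : ℕ) : Space p := WithLp.toLp 2 fun _ => 1

/-- The vector `(0, 1/p, …, (p-1)/p)`. -/
def ramp (p : ℕ) : Space p := WithLp.toLp 2 fun a => (a.val : ℝ) / p

/-- The type of orthogonal maps `O` from `ℝ^{p-1}` onto the hyperplane orthogonal to the
all-ones vector. -/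
abbrev HyperplaneFrame (p : ℕ) [NeZero p] : Type :=
  EuclideanSpace ℝ (Fin (p - 1)) ≃ₗᵢ[ℝ] ((ℝ ∙ ones p)ᗮ : Submodule ℝ (Space p))

/-- The orthogonal transform `Q = [O, 1/√p]` of `ℝ^{p-1} × ℝ` onto `ℝ^p`. -/
def transform {p : ℕ} [NeZero p] (O : HyperplaneFrame p)
    (z : EuclideanSpace ℝ (Fin (p - 1)) × ℝ) : Space p :=
  (O z.1 : Space p) + z.2 • ((Real.sqrt p)⁻¹ • ones p)

/-- The domain `B_j(κ) = 2πj (0, 1/p, …, (p-1)/p) + Q({x : ‖x‖² ≤ κ} × [0, 2√p π])`. -/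
def domainB {p : ℕ} [NeZero p] (O : HyperplaneFrame p) (j : ℕ) (κ : ℝ) : Set (Space p) :=
  (fun v => (2 * Real.pi * j) • ramp p + v) ''
    (transform O '' ({x | ‖x‖ ^ 2 ≤ κ} ×ˢ Set.Icc 0 (2 * Real.sqrt p * Real.pi)))

/-- The vector `2π m` of the period lattice `2π ℤ^p`. -/
def period {p : ℕ} (m : ZMod p → ℤ) : Space p :=
  WithLp.toLp 2 fun a => 2 * Real.pi * (m a : ℝ)

end ValueCount

end

namespace ValueCount

open Finset

/-! Put `f a = exp (i s_a)` and let `F` be its Fourier transform on `ZMod p`. Detecting zero sums by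
characters turns the characteristic function into `∑ k, F k ^ d` up to scaling and a phase. Since `d
≥ 3`, Parseval bounds its modulus by `max ‖F k‖ / p` (`exists_norm_sum_prod_le`). The hypothesis
thus gives `k` with `‖F k‖ ≥ p - α / p`. This norm is a sum of `p` cosines, so their arguments are
`ℓ²`-close to `2πℤ`: modulo periods, `s` is nearly `2πk ramp + θ ones`, which
`exists_sub_period_mem_domainB` puts into the domain. -/

/-- The discrete Fourier transform `k ↦ ∑ a, f a ψ(-(k a))` with `ψ` the standard additive
character of `ZMod p`. -/
noncomputable def fourierSum {p : ℕ} [NeZero p] (f : ZMod p → ℂ) (k : ZMod p) : ℂ :=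
  ∑ a, f a * ZMod.stdAddChar (-(k * a))

lemma sum_stdAddChar_neg_mul {p : ℕ} [NeZero p] (b : ZMod p) :
    ∑ k : ZMod p, (ZMod.stdAddChar (-(k * b)) : ℂ) = if b = 0 then (p : ℂ) else 0 := by
  have h := AddChar.sum_mulShift (R := ZMod p) (-b) (ZMod.isPrimitive_stdAddChar p)
  simpa [mul_neg, ZMod.card] using h

lemma sum_fourierSum_pow {p : ℕ} [NeZero p] (f : ZMod p → ℂ) (d : ℕ) :
    ∑ k, fourierSum f k ^ d
      = p * ∑ x : Fin d → ZMod p with ∑ i, x i = 0, ∏ i, f (x i) := by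
  have key : ∀ k, fourierSum f k ^ d
      = ∑ x : Fin d → ZMod p, (∏ i, f (x i)) * ZMod.stdAddChar (-(k * ∑ i, x i)) := by
    intro k
    have h := Finset.sum_pow' (univ : Finset (ZMod p))
      (fun a => f a * (ZMod.stdAddChar (-(k * a)) : ℂ)) d
    rw [Fintype.piFinset_univ] at h
    rw [fourierSum, h]
    refine Finset.sum_congr rfl fun x _ => ?_
    rw [Finset.prod_mul_distrib, Finset.mul_sum, ← Finset.sum_neg_distrib]
    exact congrArg _ (map_prod ZMod.stdAddChar.toMonoidHom
      (fun i => Multiplicative.ofAdd (-(k * x i))) univ).symm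
  simp_rw [key]
  rw [Finset.sum_comm, Finset.mul_sum, Finset.sum_filter]
  refine Finset.sum_congr rfl fun x _ => ?_
  rw [← Finset.mul_sum, sum_stdAddChar_neg_mul]
  split_ifs <;> ring

lemma sum_norm_sq_fourierSum {p : ℕ} [NeZero p] (f : ZMod p → ℂ) :
    ∑ k, ‖fourierSum f k‖ ^ 2 = p * ∑ a, ‖f a‖ ^ 2 := by
  have key : ∀ k, ((‖fourierSum f k‖ ^ 2 : ℝ) : ℂ)
      = ∑ a, ∑ b, f a * (starRingEnd ℂ) (f b) * ZMod.stdAddChar (-(k * (a - b))) := by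
    intro k
    push_cast
    rw [← Complex.mul_conj', fourierSum, map_sum, Finset.sum_mul_sum]
    refine Finset.sum_congr rfl fun a _ => Finset.sum_congr rfl fun b _ => ?_
    have h : -(k * (a - b)) = -(k * a) + -(-(k * b)) := by ring
    rw [h, AddChar.map_add_eq_mul, map_mul, AddChar.map_neg_eq_conj _ (-(k * b))]
    ring
  apply Complex.ofReal_injective
  rw [Complex.ofReal_sum]
  simp_rw [key]
  rw [Finset.sum_comm]
  push_cast
  rw [Finset.mul_sum]
  refine Finset.sum_congr rfl fun a _ => ?_
  rw [Finset.sum_comm]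
  simp_rw [← Finset.mul_sum, sum_stdAddChar_neg_mul, sub_eq_zero]
  simp [Complex.mul_conj', mul_comm]

lemma norm_fourierSum_le {p : ℕ} [NeZero p] {f : ZMod p → ℂ} (hf : ∀ a, ‖f a‖ = 1)
    (k : ZMod p) : ‖fourierSum f k‖ ≤ p := by
  refine (norm_sum_le _ _).trans ?_
  simp [hf, ZMod.card]

lemma card_zeroSum {p d : ℕ} [NeZero p] (hd : d ≠ 0) :
    p * #{x : Fin d → ZMod p | ∑ i, x i = 0} = p ^ d := by
  have h := sum_fourierSum_pow (fun _ : ZMod p => 1) d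
  -- The count is the case `f = 1`, whose transform is concentrated at `0`.
  have h1 : ∀ k : ZMod p, fourierSum (fun _ => 1) k = if k = 0 then (p : ℂ) else 0 := by
    intro k
    rw [← sum_stdAddChar_neg_mul k]
    simp [fourierSum, mul_comm]
  simp_rw [h1, ite_pow, zero_pow hd] at h
  simp only [Finset.sum_ite_eq', Finset.mem_univ, if_true, Finset.prod_const_one,
    Finset.sum_const, nsmul_eq_mul, mul_one] at h
  exact_mod_cast h.symm

/-- The normalized sum of `∏ i, f (x i)` over the zero-sum tuples `x` is at most the largest
normalized Fourier coefficient of `f`. -/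
lemma exists_norm_sum_prod_le {p d : ℕ} [NeZero p] (hd : 3 ≤ d) {f : ZMod p → ℂ}
    (hf : ∀ a, ‖f a‖ = 1) :
    ∃ k, p * ‖∑ x : Fin d → ZMod p with ∑ i, x i = 0, ∏ i, f (x i)‖
      ≤ ‖fourierSum f k‖ * #{x : Fin d → ZMod p | ∑ i, x i = 0} := by
  obtain ⟨k, -, hk⟩ := Finset.exists_max_image univ (fun k => ‖fourierSum f k‖)
    Finset.univ_nonempty
  refine ⟨k, ?_⟩
  obtain ⟨e, rfl⟩ := Nat.exists_eq_add_of_le' hd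
  have hp : (0 : ℝ) < p := by exact_mod_cast NeZero.pos p
  have hcard : (p : ℝ) * #{x : Fin (e + 3) → ZMod p | ∑ i, x i = 0} = p ^ (e + 3) := by
    exact_mod_cast card_zeroSum (p := p) (d := e + 3) (by omega)
  have hpars : ∑ k, ‖fourierSum f k‖ ^ 2 = (p : ℝ) ^ 2 := by
    rw [sum_norm_sq_fourierSum]
    simp [hf, ZMod.card, sq]
  have hbound : p * ‖∑ x : Fin (e + 3) → ZMod p with ∑ i, x i = 0, ∏ i, f (x i)‖
      ≤ ‖fourierSum f k‖ * p ^ e * p ^ 2 := by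
    calc p * ‖∑ x : Fin (e + 3) → ZMod p with ∑ i, x i = 0, ∏ i, f (x i)‖
        = ‖∑ k, fourierSum f k ^ (e + 3)‖ := by rw [sum_fourierSum_pow]; simp
      _ ≤ ∑ l, ‖fourierSum f l‖ ^ (e + 3) := by
          simpa only [norm_pow] using norm_sum_le univ fun l => fourierSum f l ^ (e + 3)
      -- Of the `e + 3` factors, two are kept for Parseval, one is bounded by the maximum and `e` by
      -- `p`.
      _ ≤ ∑ l, ‖fourierSum f k‖ * p ^ e * ‖fourierSum f l‖ ^ 2 := by
          refine Finset.sum_le_sum fun l _ => ?_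
          have h1 := hk l (Finset.mem_univ l)
          have h2 := norm_fourierSum_le hf l
          calc ‖fourierSum f l‖ ^ (e + 3)
              = ‖fourierSum f l‖ * ‖fourierSum f l‖ ^ e * ‖fourierSum f l‖ ^ 2 := by ring
            _ ≤ _ := by gcongr
      _ = _ := by rw [← Finset.mul_sum, hpars]
  refine le_of_mul_le_mul_left ?_ hp
  calc p * (p * ‖∑ x : Fin (e + 3) → ZMod p with ∑ i, x i = 0, ∏ i, f (x i)‖)
      ≤ p * (‖fourierSum f k‖ * p ^ e * p ^ 2) := by gcongr
    _ = ‖fourierSum f k‖ * p ^ (e + 3) := by ring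
    _ = _ := by rw [← hcard]; ring

lemma inner_countVector {p d : ℕ} [NeZero p] (s : Space p) (x : Fin d → ZMod p) :
    inner ℝ s (countVector x) = ∑ i, s (x i) := by
  rw [PiLp.inner_apply, ← Finset.sum_fiberwise univ x fun i => s (x i)]
  refine Finset.sum_congr rfl fun a _ => ?_
  rw [Finset.sum_congr rfl (g := fun _ => s a)
    fun i hi => by rw [(Finset.mem_filter.1 hi).2]]
  simp [countVector]

/-- Centering at the mean only contributes a phase. -/
lemma norm_centeredCharFun {p d : ℕ} [NeZero p] (s : Space p) :
    ‖centeredCharFun d p s‖ = (#{x : Fin d → ZMod p | ∑ i, x i = 0} : ℝ)⁻¹ *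
      ‖∑ x : Fin d → ZMod p with ∑ i, x i = 0, ∏ i, Complex.exp (s (x i) * Complex.I)‖ := by
  have h : ∀ x : Fin d → ZMod p,
      Complex.exp (Complex.I * ((inner ℝ s (countVector x - mean d p) : ℝ) : ℂ))
        = Complex.exp (((-inner ℝ s (mean d p) : ℝ) : ℂ) * Complex.I) *
          ∏ i, Complex.exp (s (x i) * Complex.I) := by
    intro x
    rw [inner_sub_right, inner_countVector, ← Complex.exp_sum, ← Complex.exp_add,
      ← Finset.sum_mul]
    congr 1
    push_cast
    ring
  have hsum : centeredCharFun d p s = (#{x : Fin d → ZMod p | ∑ i, x i = 0} : ℝ)⁻¹ •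
      ∑ x : Fin d → ZMod p with ∑ i, x i = 0,
        Complex.exp (Complex.I * ((inner ℝ s (countVector x - mean d p) : ℝ) : ℂ)) := by
    simp only [centeredCharFun, uniformExpectation, zeroSumCounts, Multiset.map_map,
      Multiset.card_map]
    rfl
  rw [hsum, Finset.sum_congr rfl fun x _ => h x, ← Finset.mul_sum, norm_smul, norm_mul,
    Complex.norm_exp_ofReal_mul_I, one_mul]
  simp

/-- A Fourier coefficient of `a ↦ exp (i s_a)`, rotated to the positive real axis, is a sum of
cosines. -/
lemma exists_norm_fourierSum_eq_sum_cos {p : ℕ} [NeZero p] (s : ZMod p → ℝ) (k : ZMod p) :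
    ∃ θ : ℝ, ‖fourierSum (fun a => Complex.exp (s a * Complex.I)) k‖
      = ∑ a : ZMod p, Real.cos (s a - 2 * Real.pi * k.val * (a.val / p) - θ) := by
  set z := fourierSum (fun a => Complex.exp (s a * Complex.I)) k with hz
  refine ⟨z.arg, ?_⟩
  have hrot : ((‖z‖ : ℝ) : ℂ) = z * Complex.exp (-(z.arg * Complex.I)) := by
    rw [Complex.exp_neg, ← div_eq_mul_inv, eq_div_iff (Complex.exp_ne_zero _),
      Complex.norm_mul_exp_arg_mul_I]
  rw [← Complex.ofReal_re ‖z‖, hrot]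
  generalize z.arg = θ
  rw [hz, fourierSum, Finset.sum_mul, Complex.re_sum]
  refine Finset.sum_congr rfl fun a _ => ?_
  have hψ : (ZMod.stdAddChar (-(k * a)) : ℂ)
      = Complex.exp (-(2 * Real.pi * k.val * (a.val / p)) * Complex.I) := by
    have hka : -(k * a) = ((-(k.val * a.val : ℤ) : ℤ) : ZMod p) := by simp
    rw [hka, ZMod.stdAddChar_coe]
    congr 1
    push_cast
    ring
  rw [hψ, ← Complex.exp_add, ← Complex.exp_add, ← Complex.exp_ofReal_mul_I_re]
  congr 2
  push_cast
  ring

/-- The squared distance from `t` to `2πℤ` is at most `π² / 2 * (1 - cos t)`. -/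
lemma exists_sub_two_pi_mul_sq_le (t : ℝ) :
    ∃ m : ℤ, (t - 2 * Real.pi * m) ^ 2 ≤ Real.pi ^ 2 / 2 * (1 - Real.cos t) := by
  have hπ := Real.pi_pos
  -- Reduce `t` to `(-π, π]`, where `cos u ≤ 1 - 2u²/π²`.
  refine ⟨toIocDiv Real.two_pi_pos (-Real.pi) t, ?_⟩
  have h := sub_toIocDiv_zsmul_mem_Ioc Real.two_pi_pos (-Real.pi) t
  set m := toIocDiv Real.two_pi_pos (-Real.pi) t
  rw [zsmul_eq_mul, mul_comm (m : ℝ)] at h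
  have hcos := Real.cos_le_one_sub_mul_cos_sq (x := t - 2 * Real.pi * m)
    (abs_le.2 ⟨h.1.le, by linarith [h.2]⟩)
  rw [mul_comm (2 * Real.pi), Real.cos_sub_int_mul_two_pi] at hcos
  rw [mul_comm (2 * Real.pi)]
  calc (t - m * (2 * Real.pi)) ^ 2
      = Real.pi ^ 2 / 2 * (2 / Real.pi ^ 2 * (t - m * (2 * Real.pi)) ^ 2) := by field_simp
    _ ≤ _ := by gcongr; linarith

/-- Lets the error be projected to the hyperplane at no cost. -/
lemma sum_sub_mean_sq_le {ι : Type*} [Fintype ι] [Nonempty ι] (η : ι → ℝ) :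
    ∑ a, (η a - (∑ b, η b) / Fintype.card ι) ^ 2 ≤ ∑ a, η a ^ 2 := by
  have hn : (0 : ℝ) < Fintype.card ι := by exact_mod_cast Fintype.card_pos
  set c := (∑ b, η b) / Fintype.card ι with hc
  have hsum : ∑ b, η b = Fintype.card ι * c := by rw [hc]; field_simp
  have : ∑ a, (η a - c) ^ 2 = ∑ a, η a ^ 2 - Fintype.card ι * c ^ 2 := by
    simp_rw [sub_sq, Finset.sum_add_distrib, Finset.sum_sub_distrib, ← Finset.sum_mul,
      ← Finset.mul_sum, hsum]
    simp
    ring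
  rw [this]
  nlinarith [sq_nonneg c]

/-- A vector agreeing with `2πj ramp + θ ones` up to an `ℓ²`-error of square at most `κ` and
up to periods lies in `domainB O j κ` modulo periods. -/
lemma exists_sub_period_mem_domainB {p : ℕ} [NeZero p] (O : HyperplaneFrame p) (s : Space p)
    (j : ℕ) (θ κ : ℝ) (m : ZMod p → ℤ)
    (h : ∑ a : ZMod p, (s a - 2 * Real.pi * j * (a.val / p) - θ - 2 * Real.pi * m a) ^ 2 ≤ κ) :
    ∃ n : ZMod p → ℤ, s - period n ∈ domainB O j κ := by
  have hp : (0 : ℝ) < p := by exact_mod_cast NeZero.pos p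
  set η : ZMod p → ℝ := fun a => s a - 2 * Real.pi * j * (a.val / p) - θ - 2 * Real.pi * m a
    with hη
  set c := (∑ b, η b) / p with hc
  have hmean : ∑ a, (η a - c) ^ 2 ≤ κ := by
    have := sum_sub_mean_sq_le η
    rw [ZMod.card] at this
    exact this.trans h
  let ε : Space p := WithLp.toLp 2 fun a => η a - c
  have hε : ε ∈ (ℝ ∙ ones p)ᗮ := by
    rw [Submodule.mem_orthogonal_singleton_iff_inner_right, PiLp.inner_apply]
    simp only [ε, ones, RCLike.inner_apply, conj_trivial, mul_one, Finset.sum_sub_distrib,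
      Finset.sum_const, Finset.card_univ, ZMod.card, nsmul_eq_mul]
    rw [hc]
    field_simp
    ring
  -- Reducing `θ + c` modulo `2π` is a period shift common to all coordinates; the factor `√p` below
  -- undoes the normalization in `transform`.
  set l := toIcoDiv Real.two_pi_pos 0 (θ + c)
  have hy := sub_toIcoDiv_zsmul_mem_Ico Real.two_pi_pos 0 (θ + c)
  rw [zsmul_eq_mul, zero_add] at hy
  refine ⟨fun a => m a + l, _, ⟨(O.symm ⟨ε, hε⟩, √p * (θ + c - l * (2 * Real.pi))),
    ⟨?_, ?_, ?_⟩, rfl⟩, ?_⟩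
  · rw [Set.mem_ofPred_eq, LinearIsometryEquiv.norm_map, Submodule.coe_norm,
      EuclideanSpace.norm_sq_eq]
    simpa [ε] using hmean
  · exact mul_nonneg (Real.sqrt_nonneg _) hy.1
  · have := mul_le_mul_of_nonneg_left hy.2.le (Real.sqrt_nonneg p)
    linarith
  · ext a
    have hsq : √(p : ℝ) ≠ 0 := (Real.sqrt_pos.2 hp).ne'
    simp only [transform]
    rw [LinearIsometryEquiv.apply_symm_apply]
    simp only [PiLp.add_apply,
      PiLp.smul_apply, PiLp.sub_apply, smul_eq_mul, ramp, ones, period, ε, hη]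
    push_cast
    field_simp
    ring

end ValueCount

theorem theorem3p1 :
    ∃ α₀ : ℝ, 0 < α₀ ∧
      ∀ (d : ℕ), 3 ≤ d → ∀ (α : ℝ), 0 < α → α ≤ α₀ →
        ∃ A : ℝ, 0 < A ∧
          ∀ (p : ℕ) [Fact p.Prime] (O : ValueCount.HyperplaneFrame p) (s : ValueCount.Space p),
            1 - α / (p : ℝ) ^ 2 ≤ ‖ValueCount.centeredCharFun d p s‖ →
              ∃ j : ℕ, j < p ∧ ∃ κ : ℝ, 0 < κ ∧ κ ≤ A / p ∧
                ∃ m : ZMod p → ℤ, s - ValueCount.period m ∈ ValueCount.domainB O j κ := by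
  -- The threshold `1` is arbitrary; `π² / 2` comes from the cosine bound.
  refine ⟨1, one_pos, fun d hd α hα _ => ⟨Real.pi ^ 2 / 2 * α, by positivity, ?_⟩⟩
  intro p _ O s hs
  have hp : (0 : ℝ) < p := by exact_mod_cast NeZero.pos p
  obtain ⟨k, hk⟩ := ValueCount.exists_norm_sum_prod_le hd
    (f := fun a => Complex.exp (s a * Complex.I)) fun a => Complex.norm_exp_ofReal_mul_I _
  obtain ⟨θ, hθ⟩ := ValueCount.exists_norm_fourierSum_eq_sum_cos s k
  have hcard : (0 : ℝ) < (Finset.univ.filter fun x : Fin d → ZMod p => ∑ i, x i = 0).card := by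
    exact_mod_cast Finset.card_pos.2 ⟨0, by simp⟩
  rw [ValueCount.norm_centeredCharFun, inv_mul_eq_div, le_div_iff₀ hcard] at hs
  have hcos : (p : ℝ) - α / p
      ≤ ∑ a : ZMod p, Real.cos (s a - 2 * Real.pi * k.val * (a.val / p) - θ) := by
    rw [← hθ]
    refine le_of_mul_le_mul_right ((le_of_eq ?_).trans
      ((mul_le_mul_of_nonneg_left hs hp.le).trans hk)) hcard
    field_simp
  choose m hm using fun a : ZMod p => ValueCount.exists_sub_two_pi_mul_sq_le
    (s a - 2 * Real.pi * k.val * (a.val / p) - θ)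
  refine ⟨k.val, ZMod.val_lt k, Real.pi ^ 2 / 2 * α / p, by positivity, le_rfl,
    ValueCount.exists_sub_period_mem_domainB O s k.val θ _ m ?_⟩
  calc _ ≤ ∑ a : ZMod p, Real.pi ^ 2 / 2 *
        (1 - Real.cos (s a - 2 * Real.pi * k.val * (a.val / p) - θ)) :=
        Finset.sum_le_sum fun a _ => hm a
    _ = Real.pi ^ 2 / 2 *
        (p - ∑ a : ZMod p, Real.cos (s a - 2 * Real.pi * k.val * (a.val / p) - θ)) := by
        rw [← Finset.mul_sum, Finset.sum_sub_distrib]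
        simp [ZMod.card]
    _ ≤ Real.pi ^ 2 / 2 * (α / p) := by gcongr; linarith
    _ = _ := by ring
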